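/- Notation. For $x\in\mathbb C^M$ let $\operatorname{supp}(x)=\{i: x_i\neq 0\}$. Write $\mathcal N_C(0,v)$ for the circularly-symmetric complex Gaussian law of variance $v$ (independent real and imaginary parts, each $\mathcal N(0,v/2)$). Observe $y=Ax+n\in\mathbb C^N$, where the $N\times M$ matrix $A$ has i.i.d. $\mathcal N_C(0,1)$ entries and the noise $n$, independent of $A$, has i.i.d. $\mathcal N_C(0,\nu^2)$ entries. For $\mathcal J\subset\{1,\dots,M\}$ let $A_{\mathcal J}$ be the matrix of the columns of $A$ with index in $\mathcal J$. For $\delta>0$, a set $\mathcal J$ with $|\mathcal J|=L$ and $y$ are $\delta$-jointly typical if $\operatorname{rank}(A_{\mathcal J})=L$ and $$\Big|\tfrac1N\|\Pi^\perp_{A_{\mathcal J}}y\|^2-\tfrac{N-L}{N}\nu^2\Big|<\delta,\qquad \Pi^\perp_{B}=I-B(B^*B)^{-1}B^*.$$ A $\delta$-joint-typicality decoder $\mathcal D$ is a rule which, given $A$ and $y$, outputs an index set that is $\delta$-jointly typical with $y$ whenever such a set exists (ties broken arbitrarily, and output arbitrary if there is none). For $\gamma\in(0,1)$ and $\|x\|_2^2=P$,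 the decoder is successful (Error Metric 3) if $\sum_{k\in\mathcal D\cap\operatorname{supp}(x)}|x_k|^2>(1-\gamma)P$. Let $p_{\mathrm{err}}(A|x)$ be the probability over $n$, for fixed $A$, that it is not successful, and let $p_{\mathrm{err}}(\mathcal D|x)=\mathbb E_A\,p_{\mathrm{err}}(A|x)$. Theorem. Let $\beta>2$, $\gamma\in(0,1)$, $P>0$ and $\nu>0$. There are constants $C_5>1$ and $\delta>0$, depending only on $\beta,\gamma,P,\nu$, such that the following holds. Let $\{x^{(M)}\in\mathbb C^M\}_M$ be a sequence of vectors with $|\operatorname{supp}(x^{(M)})|=L=\lfloor M/\beta\rfloor$ and $\|x^{(M)}\|_2^2=P$ for all sufficiently large $M$, and let the number of measurements $N=N(M)$ satisfy $N>C_5L$ for all sufficiently large $M$. Then, for every $\delta$-joint-typicality decoder $\mathcal D$: (i) $p_{\mathrm{err}}(\mathcal D|x^{(M)})\to0$ as $M\to\infty$, and the convergence is exponentially fast: there is $c>0$ with $p_{\mathrm{err}}(\mathcal D|x^{(M)})\le e^{-cM}$ for all sufficiently large $M$; (ii) for every $\xi\in(0,1]$ there is $c>0$ with $\mathbb P_A\big(p_{\mathrm{err}}(A|x^{(M)})>\xi\big)\le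 e^{-cM}$ for all sufficiently large $M$. -/

import Mathlib

open MeasureTheory ProbabilityTheory Filter Topology
open scoped ENNReal NNReal Matrix

noncomputable section

namespace SparseRecovery

/-- The circularly-symmetric complex Gaussian law with mean zero and variance `v`: real and
imaginary part are independent real Gaussians with mean `0` and variance `v / 2`. -/
def complexGaussian (v : ℝ≥0) : Measure ℂ :=
  ((gaussianReal 0 (v / 2)).prod (gaussianReal 0 (v / 2))).map
    (fun p : ℝ × ℝ => (⟨p.1, p.2⟩ : ℂ))

/-- The law on `ℂ ^ N` of a vector with i.i.d. complex Gaussian entries of variance `v`, that is,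
the circularly-symmetric complex Gaussian law with covariance `v` times the identity. -/
def complexGaussianVec (N : ℕ) (v : ℝ≥0) : Measure (Fin N → ℂ) :=
  Measure.pi fun _ : Fin N => complexGaussian v

/-- Matrices carry the product sigma-algebra of their entries. -/
instance instMeasurableSpaceMatrix {N M : ℕ} : MeasurableSpace (Matrix (Fin N) (Fin M) ℂ) :=
  inferInstanceAs (MeasurableSpace (Fin N → Fin M → ℂ))

/-- The law of an `N × M` matrix with i.i.d. standard complex Gaussian entries: its `M` columns are
independent standard complex Gaussian vectors in `ℂ ^ N`. -/
def gaussianMatrix (N M : ℕ) : Measure (Matrix (Fin N) (Fin M) ℂ) :=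
  (Measure.pi fun _ : Fin M => complexGaussianVec N 1).map
    (fun a : Fin M → Fin N → ℂ => Matrix.of fun (i : Fin N) (j : Fin M) => a j i)

/-- The support of a vector. -/
def supp {M : ℕ} (x : Fin M → ℂ) : Finset (Fin M) :=
  Finset.univ.filter fun i => x i ≠ 0

/-- The matrix `A_J` of the columns of `A` with index in `J`. -/
def cols {N M : ℕ} (A : Matrix (Fin N) (Fin M) ℂ) (J : Finset (Fin M)) : Matrix (Fin N) J ℂ :=
  A.submatrix id (fun j : J => (j : Fin M))

/-- The matrix `I - B (B* B)⁻¹ B*`. When `B` has full column rank (the only case in which it is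
used), this is the orthogonal projection onto the complement of the column space of `B`. -/
def projPerp {N : ℕ} {ι : Type} [Fintype ι] [DecidableEq ι] (B : Matrix (Fin N) ι ℂ) :
    Matrix (Fin N) (Fin N) ℂ :=
  1 - B * (Bᴴ * B)⁻¹ * Bᴴ

/-- `y` and the index set `J` (of size `L`) are `δ`-jointly typical, for the measurement matrix `A`
and noise variance `ν ^ 2`. -/
def JointlyTypical {N M : ℕ} (L : ℕ) (ν δ : ℝ) (A : Matrix (Fin N) (Fin M) ℂ) (y : Fin N → ℂ)
    (J : Finset (Fin M)) : Prop :=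
  J.card = L ∧ (cols A J).rank = L ∧
    |1 / (N : ℝ) * ∑ i, ‖(projPerp (cols A J) *ᵥ y) i‖ ^ 2
      - ((N : ℝ) - L) / N * ν ^ 2| < δ

/-- `D` is a decoder based on joint typicality: knowing the measurement matrix and the observation,
it outputs some `δ`-jointly typical index set whenever there is one. Ties may be broken in any way,
and the output is unrestricted if there is no jointly typical set. -/
def IsTypicalityDecoder {N M : ℕ} (L : ℕ) (ν δ : ℝ)
    (D : Matrix (Fin N) (Fin M) ℂ → (Fin N → ℂ) → Finset (Fin M)) : Prop :=
  ∀ A y, (∃ J, JointlyTypical L ν δ A y J) → JointlyTypical L ν δ A y (D A y)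

/-- There is always a decoder based on joint typicality. -/
theorem exists_isTypicalityDecoder {N M : ℕ} (L : ℕ) (ν δ : ℝ) :
    ∃ D : Matrix (Fin N) (Fin M) ℂ → (Fin N → ℂ) → Finset (Fin M),
      IsTypicalityDecoder L ν δ D := by
  classical
  refine ⟨fun A y => if h : ∃ J, JointlyTypical L ν δ A y J then h.choose else ∅, ?_⟩
  intro A y h
  simpa only [dif_pos h] using h.choose_spec

/-- The decoded index set `J` captures more than the fraction `1 - γ` of the energy `P` of `x`. -/
def CapturesEnergy {M : ℕ} (γ P : ℝ) (x : Fin M → ℂ) (J : Finset (Fin M)) : Prop :=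
  (1 - γ) * P < ∑ k ∈ J ∩ supp x, ‖x k‖ ^ 2

/-- Error probability of the decoder `D` for a fixed measurement matrix `A`: the probability, over
the Gaussian noise `n` with covariance `ν ^ 2` times the identity, that the set decoded from
`y = A x + n` does not capture more than the fraction `1 - γ` of the energy. -/
def pErr {N M : ℕ} (γ P ν : ℝ)
    (D : Matrix (Fin N) (Fin M) ℂ → (Fin N → ℂ) → Finset (Fin M)) (x : Fin M → ℂ)
    (A : Matrix (Fin N) (Fin M) ℂ) : ℝ≥0∞ :=
  complexGaussianVec N (ν ^ 2).toNNReal {n | ¬ CapturesEnergy γ P x (D A (A *ᵥ x + n))}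

/-- Error probability of the decoder `D`, averaged over all Gaussian measurement matrices. -/
def pErrAvg {N M : ℕ} (γ P ν : ℝ)
    (D : Matrix (Fin N) (Fin M) ℂ → (Fin N → ℂ) → Finset (Fin M)) (x : Fin M → ℂ) : ℝ≥0∞ :=
  ∫⁻ A, pErr γ P ν D x A ∂(gaussianMatrix N M)

/-- `f M` decays to zero exponentially fast as a function of `M`. -/
def ExpDecay (f : ℕ → ℝ≥0∞) : Prop :=
  ∃ c : ℝ, 0 < c ∧ ∀ᶠ M : ℕ in atTop, f M ≤ ENNReal.ofReal (Real.exp (-c * M))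

end SparseRecovery

end

noncomputable section

namespace SparseRecovery

/-! ### Complex Gaussian laws -/

/-! Fix an index set `J` of size `L` and write the observation as `A_J x_J` plus a remainder. The
projection kills the first term. The remainder involves only the noise and the columns outside `J`,
so it is independent of `A_J` and is a complex Gaussian vector whose variance is `ν ^ 2` plus the
energy of `x` outside `J` (`measurePreserving_colFamily_remainder`). Given `A_J` of full rank, the
residual is therefore the energy of a Gaussian vector in a subspace of dimension `N - L`, that is,
in `N - L` coordinates after a unitary change of basis. Its Laplace transform is explicit, and
Chernoff bounds follow.

For `J = supp x` the variance is `ν ^ 2`, so `supp x` is typical except with probability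
exponentially small in `N` (`complexGaussianVec_deviation`). A set that fails to capture the energy
has variance at least `ν ^ 2 + γ P`, and its residual stays below the typicality threshold with
probability at most `exp (-q N)`, where `q` depends only on `γ P` and `ν ^ 2`
(`complexGaussianVec_energy_small`). A union bound over at most `2 ^ M` sets is affordable once `M ≤
q N`, which is what a large `C₅` provides.

The decoder need not be measurable, so its error event is enclosed in a measurable event
(`exists_majorant_pErr`). Integrating the conditional probability of that event bounds the average
error, and Markov's inequality gives the statement about most matrices. -/

instance isProbabilityMeasure_complexGaussian (v : ℝ≥0) :
    IsProbabilityMeasure (complexGaussian v) :=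
  Measure.isProbabilityMeasure_map
    Complex.measurableEquivRealProd.symm.measurable.aemeasurable

instance isProbabilityMeasure_complexGaussianVec (N : ℕ) (v : ℝ≥0) :
    IsProbabilityMeasure (complexGaussianVec N v) := by
  unfold complexGaussianVec; infer_instance

lemma measurable_matrix_of_transpose (N M : ℕ) :
    Measurable (fun a : Fin M → Fin N → ℂ => Matrix.of fun (i : Fin N) (j : Fin M) => a j i) := by
  refine measurable_pi_lambda _ fun i => measurable_pi_lambda _ fun j => ?_
  exact (measurable_pi_apply i).comp (measurable_pi_apply j)

instance isProbabilityMeasure_gaussianMatrix (N M : ℕ) :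
    IsProbabilityMeasure (gaussianMatrix N M) :=
  Measure.isProbabilityMeasure_map (measurable_matrix_of_transpose N M).aemeasurable

lemma charFunDual_gaussianReal_zero (v : ℝ≥0) (L : StrongDual ℝ ℝ) :
    charFunDual (gaussianReal 0 v) L = Complex.exp (-(v * (L 1 : ℂ) ^ 2 / 2)) := by
  have h := charFun_gaussianReal (μ := 0) (v := v) (L 1)
  rw [charFun_apply_real] at h
  rw [charFunDual_apply]
  obtain ⟨c, hc⟩ : ∃ c, c = L 1 := ⟨_, rfl⟩
  rw [← hc] at h ⊢
  have hL : ∀ x : ℝ, L x = c * x := fun x => by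
    rw [hc, mul_comm, ← smul_eq_mul, ← map_smul, smul_eq_mul, mul_one]
  simp_rw [hL, Complex.ofReal_mul]
  rw [h]
  congr 1
  push_cast
  ring

/-- The complex number representing a real functional on `ℂ`. -/
def dualCoeff (K : StrongDual ℝ ℂ) : ℂ := ⟨K 1, -K Complex.I⟩

lemma dual_apply_eq_re_mul (K : StrongDual ℝ ℂ) (z : ℂ) : K z = (dualCoeff K * z).re := by
  have hz : z = z.re • (1 : ℂ) + z.im • Complex.I := by
    simp [Complex.re_add_im]
  conv_lhs => rw [hz]
  rw [map_add, map_smul, map_smul]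
  simp [dualCoeff]
  ring

lemma dualCoeff_eq_of_forall {K : StrongDual ℝ ℂ} {c : ℂ} (h : ∀ z, K z = (c * z).re) :
    dualCoeff K = c := by
  apply Complex.ext
  · simp [dualCoeff, h]
  · simp [dualCoeff, h]

/-- Only the modulus of the coefficient of `K` enters. This circular symmetry is what makes
complex-linear images of Gaussian vectors computable by comparing characteristic functions. -/
lemma charFunDual_complexGaussian (v : ℝ≥0) (K : StrongDual ℝ ℂ) :
    charFunDual (complexGaussian v) K = Complex.exp (-((v * ‖dualCoeff K‖ ^ 2 / 4 : ℝ) : ℂ)) := by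
  have h : complexGaussian v = ((gaussianReal 0 (v / 2)).prod (gaussianReal 0 (v / 2))).map
      (Complex.equivRealProdCLM.symm : ℝ × ℝ →L[ℝ] ℂ) := rfl
  rw [h, charFunDual_map, charFunDual_prod, charFunDual_gaussianReal_zero,
    charFunDual_gaussianReal_zero, ← Complex.exp_add]
  congr 1
  rw [Complex.sq_norm, Complex.normSq_apply]
  have h1 : (Complex.equivRealProdCLM.symm (1, 0) : ℂ) = 1 := by
    simp [Complex.equivRealProdCLM_symm_apply]
  have h2 : (Complex.equivRealProdCLM.symm (0, 1) : ℂ) = Complex.I := by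
    simp [Complex.equivRealProdCLM_symm_apply]
  simp only [ContinuousLinearMap.comp_apply, ContinuousLinearMap.inl_apply,
    ContinuousLinearMap.inr_apply, ContinuousLinearEquiv.coe_coe, h1, h2, dualCoeff]
  push_cast
  ring

lemma charFunDual_complexGaussianVec (N : ℕ) (v : ℝ≥0) (L : StrongDual ℝ (Fin N → ℂ)) :
    charFunDual (complexGaussianVec N v) L =
      Complex.exp (-((v * (∑ i, ‖dualCoeff (L.comp (.single ℝ (fun _ => ℂ) i))‖ ^ 2) / 4 : ℝ) : ℂ)) := by
  rw [complexGaussianVec, charFunDual_pi]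
  simp_rw [charFunDual_complexGaussian]
  rw [← Complex.exp_sum]
  congr 1
  rw [Finset.sum_neg_distrib, ← Complex.ofReal_sum, Finset.mul_sum, Finset.sum_div]

/-- The complex vector representing a real functional on `ℂ ^ N`. -/
def dualVec {N : ℕ} (L : StrongDual ℝ (Fin N → ℂ)) : Fin N → ℂ :=
  fun i => dualCoeff (L.comp (.single ℝ (fun _ => ℂ) i))

lemma dual_apply_eq_re_dotProduct {N : ℕ} (L : StrongDual ℝ (Fin N → ℂ)) (z : Fin N → ℂ) :
    L z = (dualVec L ⬝ᵥ z).re := by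
  rw [← L.sum_comp_single, dotProduct, Complex.re_sum]
  refine Finset.sum_congr rfl fun i _ => ?_
  rw [dualVec, ← dual_apply_eq_re_mul]

lemma dualVec_eq_of_forall {N : ℕ} {L : StrongDual ℝ (Fin N → ℂ)} {c : Fin N → ℂ}
    (h : ∀ z, L z = (c ⬝ᵥ z).re) : dualVec L = c := by
  ext1 i
  refine dualCoeff_eq_of_forall fun z => ?_
  simp [h]

/-- A linear functional of a complex Gaussian vector is complex Gaussian. -/
lemma complexGaussianVec_map_dotProduct (N : ℕ) (v : ℝ≥0) (c : Fin N → ℂ) :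
    (complexGaussianVec N v).map (fun z => c ⬝ᵥ z) =
      complexGaussian (v * ∑ i, ‖c i‖₊ ^ 2) := by
  let T : (Fin N → ℂ) →L[ℝ] ℂ :=
    (LinearMap.toContinuousLinearMap (dotProductBilin ℝ ℝ c))
  have hT : (fun z => c ⬝ᵥ z) = T := rfl
  have : IsProbabilityMeasure ((complexGaussianVec N v).map T) :=
    Measure.isProbabilityMeasure_map T.continuous.measurable.aemeasurable
  rw [hT]
  refine Measure.ext_of_charFunDual <| funext fun K => ?_
  rw [charFunDual_map, charFunDual_complexGaussianVec, charFunDual_complexGaussian]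
  have : dualVec (K.comp T) = fun i => dualCoeff K * c i := by
    refine dualVec_eq_of_forall fun z => ?_
    rw [ContinuousLinearMap.comp_apply, dual_apply_eq_re_mul, ← hT]
    simp only [dotProduct, Finset.mul_sum, mul_assoc]
  have h2 : ∀ i, dualCoeff ((K.comp T).comp (.single ℝ (fun _ => ℂ) i)) = dualCoeff K * c i :=
    fun i => congrFun this i
  simp_rw [h2, norm_mul, mul_pow]
  rw [← Finset.mul_sum]
  congr 3
  push_cast
  ring

/-- Complex Gaussian vectors are invariant in law under unitary matrices. -/
lemma complexGaussianVec_map_unitary {N : ℕ} (v : ℝ≥0) {U : Matrix (Fin N) (Fin N) ℂ}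
    (hU : U * Uᴴ = 1) :
    (complexGaussianVec N v).map (fun z => U *ᵥ z) = complexGaussianVec N v := by
  let T : (Fin N → ℂ) →L[ℝ] (Fin N → ℂ) :=
    LinearMap.toContinuousLinearMap (U.mulVecLin.restrictScalars ℝ)
  have hT : (fun z => U *ᵥ z) = T := rfl
  have : IsProbabilityMeasure ((complexGaussianVec N v).map T) :=
    Measure.isProbabilityMeasure_map T.continuous.measurable.aemeasurable
  rw [hT]
  refine Measure.ext_of_charFunDual <| funext fun K => ?_
  rw [charFunDual_map, charFunDual_complexGaussianVec, charFunDual_complexGaussianVec]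
  have h1 : dualVec (K.comp T) = dualVec K ᵥ* U := by
    refine dualVec_eq_of_forall fun z => ?_
    rw [ContinuousLinearMap.comp_apply, dual_apply_eq_re_dotProduct, ← hT,
      Matrix.dotProduct_mulVec]
  have h2 : ∀ c : Fin N → ℂ, ((∑ i, ‖c i‖ ^ 2 : ℝ) : ℂ) = c ⬝ᵥ star c := fun c => by
    simp [dotProduct, Complex.mul_conj, Complex.normSq_eq_norm_sq]
  have h3 : ∑ i, ‖dualVec (K.comp T) i‖ ^ 2 = ∑ i, ‖dualVec K i‖ ^ 2 := by
    apply Complex.ofReal_injective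
    rw [h2, h2, h1, Matrix.star_vecMul, ← Matrix.dotProduct_mulVec, Matrix.mulVec_mulVec, hU,
      Matrix.one_mulVec]
  change Complex.exp (-((v * (∑ i, ‖dualVec (K.comp T) i‖ ^ 2) / 4 : ℝ) : ℂ)) = _
  rw [h3]
  rfl

/-- A linear combination of independent complex Gaussian vectors plus an independent complex
Gaussian vector is complex Gaussian. -/
lemma map_sum_smul_add {N : ℕ} {ι : Type*} [Fintype ι] (x : ι → ℂ) (v : ℝ≥0) :
    ((Measure.pi fun _ : ι => complexGaussianVec N 1).prod (complexGaussianVec N v)).map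
      (fun p => (∑ k, x k • p.1 k) + p.2) = complexGaussianVec N (∑ k, ‖x k‖₊ ^ 2 + v) := by
  classical
  let T : ((ι → Fin N → ℂ) × (Fin N → ℂ)) →L[ℝ] (Fin N → ℂ) :=
    (∑ k, x k • ((ContinuousLinearMap.proj k).comp
      (ContinuousLinearMap.fst ℝ (ι → Fin N → ℂ) (Fin N → ℂ)))) + ContinuousLinearMap.snd ℝ _ _
  have hT : (fun p : (ι → Fin N → ℂ) × (Fin N → ℂ) => (∑ k, x k • p.1 k) + p.2) = T := by
    ext1 p
    simp [T]
  have : IsProbabilityMeasure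
      (((Measure.pi fun _ : ι => complexGaussianVec N 1).prod (complexGaussianVec N v)).map T) :=
    Measure.isProbabilityMeasure_map T.continuous.measurable.aemeasurable
  rw [hT]
  refine Measure.ext_of_charFunDual <| funext fun K => ?_
  rw [charFunDual_map, charFunDual_prod, charFunDual_pi, charFunDual_complexGaussianVec,
    charFunDual_complexGaussianVec]
  simp_rw [charFunDual_complexGaussianVec]
  rw [← Complex.exp_sum, ← Complex.exp_add]
  have h1 : ∀ k, dualVec (((K.comp T).comp (.inl ℝ _ _)).comp (.single ℝ (fun _ => Fin N → ℂ) k)) =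
      x k • dualVec K := fun k => by
    refine dualVec_eq_of_forall fun z => ?_
    have : T (Pi.single k z, 0) = x k • z := by
      rw [← hT]
      simp [Pi.single_apply]
    simp [this, dual_apply_eq_re_dotProduct K]
  have h2 : dualVec ((K.comp T).comp (.inr ℝ _ _)) = dualVec K := by
    refine dualVec_eq_of_forall fun z => ?_
    have : T (0, z) = z := by rw [← hT]; simp
    simp [this, dual_apply_eq_re_dotProduct K]
  change Complex.exp ((∑ k, -((((1 : ℝ≥0) : ℝ) * (∑ i, ‖dualVec
    (((K.comp T).comp (.inl ℝ _ _)).comp (.single ℝ (fun _ => Fin N → ℂ) k)) i‖ ^ 2) / 4 : ℝ) : ℂ)) +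
    -((v * (∑ i, ‖dualVec ((K.comp T).comp (.inr ℝ _ _)) i‖ ^ 2) / 4 : ℝ) : ℂ)) =
    Complex.exp (-((((∑ k, ‖x k‖₊ ^ 2 + v : ℝ≥0) : ℝ) * (∑ i, ‖dualVec K i‖ ^ 2) / 4 : ℝ) : ℂ))
  simp_rw [h1, h2]
  congr 1
  rw [Finset.sum_neg_distrib, ← Complex.ofReal_sum, ← neg_add, ← Complex.ofReal_add]
  congr 2
  simp only [Pi.smul_apply, smul_eq_mul, norm_mul, mul_pow, ← Finset.mul_sum, NNReal.coe_add,
    NNReal.coe_sum, NNReal.coe_pow, coe_nnnorm, NNReal.coe_one, one_mul, ← Finset.sum_div,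
    ← Finset.sum_mul]
  ring

/-! ### Laplace transforms and null sets of complex Gaussian laws -/

/-- Negative `s` is allowed as long as the integral converges, so that one formula serves both the
upper and the lower tail. -/
lemma lintegral_exp_neg_mul_sq_gaussianReal {v : ℝ≥0} (hv : v ≠ 0) {s : ℝ}
    (hs : 0 < 1 + s * v * 2) :
    ∫⁻ x, ENNReal.ofReal (Real.exp (-(s * x ^ 2))) ∂(gaussianReal 0 v) =
      ENNReal.ofReal ((√(1 + s * v * 2))⁻¹) := by
  have hv' : (0 : ℝ) < v := by positivity
  have hb : 0 < (2 * v : ℝ)⁻¹ + s := by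
    have : (2 * v : ℝ)⁻¹ + s = (1 + s * v * 2) / (2 * v) := by field_simp
    rw [this]; positivity
  rw [gaussianReal_of_var_ne_zero 0 hv,
    lintegral_withDensity_eq_lintegral_mul _ (measurable_gaussianPDF 0 v) (by fun_prop)]
  have h1 : ∀ x : ℝ, (gaussianPDF 0 v * fun x => ENNReal.ofReal (Real.exp (-(s * x ^ 2)))) x =
      ENNReal.ofReal ((√(2 * Real.pi * v))⁻¹ * Real.exp (-((2 * v : ℝ)⁻¹ + s) * x ^ 2)) := by
    intro x
    rw [Pi.mul_apply, gaussianPDF, ← ENNReal.ofReal_mul (gaussianPDFReal_nonneg _ _ _),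
      gaussianPDFReal, mul_assoc, ← Real.exp_add]
    congr 3
    field_simp
    ring
  simp_rw [h1]
  rw [← ofReal_integral_eq_lintegral_ofReal]
  · congr 1
    rw [integral_const_mul, integral_gaussian, ← Real.sqrt_inv, ← Real.sqrt_inv,
      ← Real.sqrt_mul (by positivity)]
    congr 1
    field_simp
  · exact (integrable_exp_neg_mul_sq hb).const_mul _
  · exact Eventually.of_forall fun x => by positivity

lemma lintegral_exp_neg_mul_norm_sq_complexGaussian {v : ℝ≥0} (hv : v ≠ 0) {s : ℝ}
    (hs : 0 < 1 + s * v) :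
    ∫⁻ z, ENNReal.ofReal (Real.exp (-(s * ‖z‖ ^ 2))) ∂(complexGaussian v) =
      ENNReal.ofReal ((1 + s * v)⁻¹) := by
  have hm : Measurable (fun p : ℝ × ℝ => (⟨p.1, p.2⟩ : ℂ)) :=
    Complex.measurableEquivRealProd.symm.measurable
  rw [complexGaussian, lintegral_map (by fun_prop) hm]
  have h1 : ∀ p : ℝ × ℝ, ENNReal.ofReal (Real.exp (-(s * ‖(⟨p.1, p.2⟩ : ℂ)‖ ^ 2))) =
      ENNReal.ofReal (Real.exp (-(s * p.1 ^ 2))) * ENNReal.ofReal (Real.exp (-(s * p.2 ^ 2))) := by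
    intro p
    rw [← ENNReal.ofReal_mul (Real.exp_nonneg _), ← Real.exp_add, Complex.sq_norm,
      Complex.normSq_apply]
    congr 2
    ring
  simp_rw [h1]
  have hv2 : v / 2 ≠ 0 := by positivity
  have hs2 : 1 + s * ((v / 2 : ℝ≥0) : ℝ) * 2 = 1 + s * v := by push_cast; ring
  rw [lintegral_prod_mul (f := fun x => ENNReal.ofReal (Real.exp (-(s * x ^ 2))))
      (g := fun x => ENNReal.ofReal (Real.exp (-(s * x ^ 2)))) (by fun_prop) (by fun_prop),
    lintegral_exp_neg_mul_sq_gaussianReal hv2 (by rw [hs2]; exact hs), hs2,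
    ← ENNReal.ofReal_mul (by positivity), ← mul_inv, Real.mul_self_sqrt hs.le]

lemma complexGaussian_singleton_zero {v : ℝ≥0} (hv : v ≠ 0) : complexGaussian v {0} = 0 := by
  have hm : Measurable (fun p : ℝ × ℝ => (⟨p.1, p.2⟩ : ℂ)) :=
    Complex.measurableEquivRealProd.symm.measurable
  rw [complexGaussian, Measure.map_apply hm (measurableSet_singleton _)]
  have hv2 : v / 2 ≠ 0 := by positivity
  have := nullSingletonClass_gaussianReal (μ := 0) hv2
  refine measure_mono_null (t := ({0} : Set ℝ) ×ˢ Set.univ) ?_ ?_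
  · rintro ⟨a, b⟩ h
    simpa using congrArg Complex.re h
  · rw [Measure.prod_prod, measure_singleton, zero_mul]

/-- A proper complex subspace is a null set of a nondegenerate complex Gaussian vector. -/
lemma complexGaussianVec_submodule {N : ℕ} {v : ℝ≥0} (hv : v ≠ 0)
    {S : Submodule ℂ (Fin N → ℂ)} (hS : S ≠ ⊤) :
    complexGaussianVec N v (S : Set (Fin N → ℂ)) = 0 := by
  obtain ⟨f, hf0, hf⟩ := S.exists_le_ker_of_lt_top hS.lt_top
  set c : Fin N → ℂ := fun i => f (Pi.single i 1) with hc
  have hfc : ∀ z, f z = c ⬝ᵥ z := fun z => by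
    rw [f.pi_apply_eq_sum_univ z, dotProduct]
    refine Finset.sum_congr rfl fun i _ => ?_
    have : (fun j => if i = j then (1 : ℂ) else 0) = Pi.single i 1 := by
      ext j; simp [Pi.single_apply, eq_comm]
    rw [this, smul_eq_mul, mul_comm]
  have hc0 : v * ∑ i, ‖c i‖₊ ^ 2 ≠ 0 := by
    refine mul_ne_zero hv fun h => hf0 ?_
    rw [Finset.sum_eq_zero_iff] at h
    have hc : c = 0 := by
      ext i; simpa using h i (Finset.mem_univ i)
    refine LinearMap.ext fun z => ?_
    simp [hfc, hc]
  have hm : Measurable (fun z : Fin N → ℂ => c ⬝ᵥ z) := by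
    unfold dotProduct; fun_prop
  have h0 := complexGaussian_singleton_zero hc0
  rw [← complexGaussianVec_map_dotProduct,
    Measure.map_apply hm (measurableSet_singleton _)] at h0
  refine measure_mono_null (fun z hz => ?_) h0
  have := hf hz
  simpa [hfc] using this

/-! ### Projections of complex Gaussian vectors -/

section projPerp

variable {N : ℕ} {ι : Type} [Fintype ι] [DecidableEq ι]

lemma projPerp_isHermitian (B : Matrix (Fin N) ι ℂ) : (projPerp B).IsHermitian := by
  unfold projPerp
  refine Matrix.isHermitian_one.sub ?_
  exact Matrix.isHermitian_mul_mul_conjTranspose B (Matrix.isHermitian_conjTranspose_mul_self B).inv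

lemma projPerp_mul_self_eq_zero {B : Matrix (Fin N) ι ℂ} (hB : (Bᴴ * B).det ≠ 0) :
    projPerp B * B = 0 := by
  have hu : IsUnit (Bᴴ * B).det := isUnit_iff_ne_zero.mpr hB
  rw [projPerp, Matrix.sub_mul, Matrix.one_mul, Matrix.mul_assoc, Matrix.mul_assoc,
    Matrix.nonsing_inv_mul _ hu, Matrix.mul_one, sub_self]

lemma projPerp_mul_projPerp {B : Matrix (Fin N) ι ℂ} (hB : (Bᴴ * B).det ≠ 0) :
    projPerp B * projPerp B = projPerp B := by
  conv_lhs => rhs; unfold projPerp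
  rw [mul_sub, mul_one, ← Matrix.mul_assoc, ← Matrix.mul_assoc, projPerp_mul_self_eq_zero hB,
    Matrix.zero_mul, Matrix.zero_mul, sub_zero]

lemma trace_projPerp {B : Matrix (Fin N) ι ℂ} (hB : (Bᴴ * B).det ≠ 0) :
    (projPerp B).trace = N - Fintype.card ι := by
  have hu : IsUnit (Bᴴ * B).det := isUnit_iff_ne_zero.mpr hB
  rw [projPerp, Matrix.trace_sub, Matrix.trace_mul_comm, ← Matrix.mul_assoc,
    Matrix.mul_nonsing_inv _ hu, Matrix.trace_one, Matrix.trace_one, Fintype.card_fin]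

end projPerp

lemma eigenvalues_eq_zero_or_one {n : Type*} [Fintype n] [DecidableEq n] {A : Matrix n n ℂ}
    (hA : A.IsHermitian) (h : A * A = A) (i : n) : hA.eigenvalues i = 0 ∨ hA.eigenvalues i = 1 := by
  have h1 := hA.mulVec_eigenvectorBasis i
  have h2 : A *ᵥ (A *ᵥ (hA.eigenvectorBasis i).ofLp) = A *ᵥ (hA.eigenvectorBasis i).ofLp := by
    rw [Matrix.mulVec_mulVec, h]
  rw [h1, Matrix.mulVec_smul, h1, smul_smul] at h2
  have hne : (hA.eigenvectorBasis i).ofLp ≠ 0 := fun h0 =>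
    hA.eigenvectorBasis.orthonormal.ne_zero i ((WithLp.ofLp_eq_zero _).mp h0)
  have h3 := smul_left_injective ℝ hne h2
  exact IsIdempotentElem.iff_eq_zero_or_one.mp h3

/-- In suitable unitary coordinates, an orthogonal projection is a coordinate projection. -/
lemma exists_unitary_norm_mulVec_sq {N k : ℕ} {A : Matrix (Fin N) (Fin N) ℂ}
    (hA : A.IsHermitian) (h : A * A = A) (hk : A.trace = k) :
    ∃ (W : Matrix (Fin N) (Fin N) ℂ) (S : Finset (Fin N)), W * Wᴴ = 1 ∧ S.card = k ∧
      ∀ z, ∑ i, ‖(A *ᵥ z) i‖ ^ 2 = ∑ i ∈ S, ‖(W *ᵥ z) i‖ ^ 2 := by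
  set l := hA.eigenvalues with hl
  have hl01 : ∀ i, l i = if l i = 1 then 1 else 0 := fun i => by
    rcases eigenvalues_eq_zero_or_one hA h i with h | h <;> simp [hl, h]
  set U : Matrix (Fin N) (Fin N) ℂ := (hA.eigenvectorUnitary : Matrix (Fin N) (Fin N) ℂ) with hU
  have hUU : Uᴴ * U = 1 := Unitary.coe_star_mul_self hA.eigenvectorUnitary
  refine ⟨Uᴴ, Finset.univ.filter fun i => l i = 1, ?_, ?_, ?_⟩
  · rwa [Matrix.conjTranspose_conjTranspose]
  · have ht := hA.trace_eq_sum_eigenvalues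
    rw [hk] at ht
    have ht' : (k : ℂ) = ((∑ i, l i : ℝ) : ℂ) := by rw [ht]; push_cast; rfl
    have ht2 : (k : ℝ) = ∑ i, l i := by exact_mod_cast ht'
    rw [Finset.sum_congr rfl fun i _ => hl01 i, Finset.sum_boole] at ht2
    exact_mod_cast ht2.symm
  · intro z
    have hnorm : ∀ w : Fin N → ℂ, ((∑ i, ‖w i‖ ^ 2 : ℝ) : ℂ) = star w ⬝ᵥ w := fun w => by
      simp [dotProduct, Complex.conj_mul']
    have hspec : A = U * Matrix.diagonal (fun i => (l i : ℂ)) * Uᴴ := by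
      conv_lhs => rw [hA.spectral_theorem]
      rw [Unitary.conjStarAlgAut_apply]
      rfl
    -- As `A` is Hermitian and idempotent, `‖A z‖ ^ 2 = z* A z`, and this form is diagonal in the
    -- eigenbasis.
    apply Complex.ofReal_injective
    rw [hnorm, Matrix.star_mulVec, ← Matrix.dotProduct_mulVec, Matrix.mulVec_mulVec, hA.eq, h]
    conv_lhs => rw [hspec]
    rw [← Matrix.mulVec_mulVec, ← Matrix.mulVec_mulVec, Matrix.dotProduct_mulVec]
    have : star z ᵥ* U = star (Uᴴ *ᵥ z) := by
      rw [Matrix.star_mulVec, Matrix.conjTranspose_conjTranspose]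
    rw [this, Finset.sum_filter, Complex.ofReal_sum, dotProduct]
    refine Finset.sum_congr rfl fun i _ => ?_
    rw [Matrix.mulVec_diagonal, Pi.star_apply]
    rcases eigenvalues_eq_zero_or_one hA h i with h | h
    · have : l i = 0 := h
      simp [this]
    · have : l i = 1 := h
      simp [this, Complex.conj_mul']

/-! ### Tail bounds by the Chernoff method -/

/-- Moment generating function of the energy of a complex Gaussian vector in a `k`-dimensional
coordinate subspace. -/
lemma lintegral_exp_neg_mul_sum_norm_sq {N : ℕ} {v : ℝ≥0} (hv : v ≠ 0) {s : ℝ}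
    (hs : 0 < 1 + s * v) (S : Finset (Fin N)) :
    ∫⁻ z, ENNReal.ofReal (Real.exp (-(s * ∑ i ∈ S, ‖z i‖ ^ 2))) ∂(complexGaussianVec N v) =
      ENNReal.ofReal ((1 + s * v)⁻¹ ^ S.card) := by
  -- Coordinates outside `S` contribute the factor `1`, so that independence of all `N` coordinates
  -- applies directly.
  have hind : iIndepFun (fun (i : Fin N) (z : Fin N → ℂ) =>
      if i ∈ S then ENNReal.ofReal (Real.exp (-(s * ‖z i‖ ^ 2))) else 1)
      (complexGaussianVec N v) :=
    iIndepFun_pi (X := fun (i : Fin N) (z : ℂ) =>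
      if i ∈ S then ENNReal.ofReal (Real.exp (-(s * ‖z‖ ^ 2))) else 1) fun i => by
        by_cases hi : i ∈ S
        · simp only [hi, if_true]; fun_prop
        · simp only [hi, if_false]; fun_prop
  have hexp : ∀ z : Fin N → ℂ, ENNReal.ofReal (Real.exp (-(s * ∑ i ∈ S, ‖z i‖ ^ 2))) =
      ∏ i, if i ∈ S then ENNReal.ofReal (Real.exp (-(s * ‖z i‖ ^ 2))) else 1 := fun z => by
    rw [Finset.prod_ite_mem, Finset.univ_inter, Finset.mul_sum, ← Finset.sum_neg_distrib,
      Real.exp_sum, ENNReal.ofReal_prod_of_nonneg fun _ _ => Real.exp_nonneg _]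
  simp_rw [hexp]
  rw [lintegral_prod_eq_prod_lintegral_of_indepFun Finset.univ _ hind fun i => by
    by_cases hi : i ∈ S
    · simp only [hi, if_true]; fun_prop
    · simp only [hi, if_false]; fun_prop]
  have hfac : ∀ i, ∫⁻ z : Fin N → ℂ, (if i ∈ S then ENNReal.ofReal (Real.exp (-(s * ‖z i‖ ^ 2)))
      else 1) ∂(complexGaussianVec N v) =
      if i ∈ S then ENNReal.ofReal ((1 + s * v)⁻¹) else 1 := fun i => by
    by_cases hi : i ∈ S
    · simp only [hi, if_true]
      rw [← lintegral_exp_neg_mul_norm_sq_complexGaussian hv hs]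
      exact (measurePreserving_eval (fun _ : Fin N => complexGaussian v) i).lintegral_comp
        (f := fun z => ENNReal.ofReal (Real.exp (-(s * ‖z‖ ^ 2)))) (by fun_prop)
    · simp [hi]
  rw [Finset.prod_congr rfl fun i _ => hfac i, Finset.prod_ite_mem, Finset.univ_inter,
    Finset.prod_const, ENNReal.ofReal_pow (by positivity)]

/-- Chernoff bound for the energy of a complex Gaussian vector in a `k`-dimensional subspace. -/
lemma complexGaussianVec_chernoff {N k : ℕ} {A : Matrix (Fin N) (Fin N) ℂ}
    (hA : A.IsHermitian) (h : A * A = A) (hk : A.trace = k) {v : ℝ≥0} (hv : v ≠ 0) {s : ℝ}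
    (hs : 0 < 1 + s * v) (r : ℝ) :
    complexGaussianVec N v {z | s * ∑ i, ‖(A *ᵥ z) i‖ ^ 2 ≤ r} ≤
      ENNReal.ofReal (Real.exp r * (1 + s * v)⁻¹ ^ k) := by
  obtain ⟨W, S, hW, hS, hWS⟩ := exists_unitary_norm_mulVec_sq hA h hk
  have hmW : Measurable fun z : Fin N → ℂ => W *ᵥ z :=
    (Continuous.matrix_mulVec continuous_const continuous_id).measurable
  have hset : {z : Fin N → ℂ | s * ∑ i, ‖(A *ᵥ z) i‖ ^ 2 ≤ r} =
      (fun z => W *ᵥ z) ⁻¹' {w | s * ∑ i ∈ S, ‖w i‖ ^ 2 ≤ r} := by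
    ext z; simp [hWS]
  rw [hset, ← Measure.map_apply hmW (measurableSet_le (by fun_prop) (by fun_prop)),
    complexGaussianVec_map_unitary v hW]
  have hmarkov := mul_meas_ge_le_lintegral (μ := complexGaussianVec N v)
    (f := fun z => ENNReal.ofReal (Real.exp (-(s * ∑ i ∈ S, ‖z i‖ ^ 2)))) (by fun_prop)
    (ENNReal.ofReal (Real.exp (-r)))
  rw [lintegral_exp_neg_mul_sum_norm_sq hv hs, hS] at hmarkov
  have hset2 : {w : Fin N → ℂ | s * ∑ i ∈ S, ‖w i‖ ^ 2 ≤ r} =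
      {x | ENNReal.ofReal (Real.exp (-r)) ≤
        ENNReal.ofReal (Real.exp (-(s * ∑ i ∈ S, ‖x i‖ ^ 2)))} := by
    ext w
    simp only [Set.mem_ofPred_eq]
    rw [ENNReal.ofReal_le_ofReal_iff (Real.exp_nonneg _), Real.exp_le_exp, neg_le_neg_iff]
  rw [hset2]
  rw [ENNReal.ofReal_mul (Real.exp_nonneg _)]
  have hinv : ENNReal.ofReal (Real.exp r) * ENNReal.ofReal (Real.exp (-r)) = 1 := by
    rw [← ENNReal.ofReal_mul (Real.exp_nonneg _), ← Real.exp_add]; simp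
  calc _ = ENNReal.ofReal (Real.exp r) * (ENNReal.ofReal (Real.exp (-r)) *
        complexGaussianVec N v {x | ENNReal.ofReal (Real.exp (-r)) ≤
        ENNReal.ofReal (Real.exp (-(s * ∑ i ∈ S, ‖x i‖ ^ 2)))}) := by
          rw [← mul_assoc, hinv, one_mul]
    _ ≤ _ := by gcongr

/-- From `exp w ≥ 1 + w` at `w = -u + u ^ 2`, because `(1 + u) (1 - u + u ^ 2) = 1 + u ^ 3`. -/
lemma inv_one_add_le_exp {u : ℝ} (hu : 0 ≤ u) : (1 + u)⁻¹ ≤ Real.exp (-u + u ^ 2) := by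
  have h2 := Real.add_one_le_exp (-u + u ^ 2)
  refine le_trans ?_ h2
  rw [inv_le_iff_one_le_mul₀ (by positivity)]
  nlinarith [pow_nonneg hu 3]

/-- Here `exp w ≥ 1 + w` is not enough, since `(1 - u) (1 + u + u ^ 2) = 1 - u ^ 3`. The quadratic
term of the exponential makes up for the loss when `u ≤ 1 / 2`. -/
lemma inv_one_sub_le_exp {u : ℝ} (hu : 0 ≤ u) (hu2 : u ≤ 1 / 2) :
    (1 - u)⁻¹ ≤ Real.exp (u + u ^ 2) := by
  have h2 := Real.quadratic_le_exp_of_nonneg (x := u + u ^ 2) (by positivity)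
  refine le_trans ?_ h2
  rw [inv_le_iff_one_le_mul₀ (by linarith)]
  have h3 : 0 ≤ u ^ 2 * ((1 / 2 - u) * (1 + u)) := by
    have : 0 ≤ 1 / 2 - u := by linarith
    positivity
  nlinarith [pow_nonneg hu 5, pow_nonneg hu 4, h3, mul_nonneg (pow_nonneg hu 4) (sub_nonneg.2 hu2)]

/-- The energy of a complex Gaussian vector in a `k`-dimensional subspace concentrates around
its mean. -/
lemma complexGaussianVec_deviation {N k : ℕ} {A : Matrix (Fin N) (Fin N) ℂ}
    (hA : A.IsHermitian) (h : A * A = A) (hk : A.trace = k) (hkN : k ≤ N) {v : ℝ≥0} (hv : v ≠ 0)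
    {δ u : ℝ} (hu : 0 ≤ u) (hu2 : u ≤ 1 / 2) (huδ : u ≤ δ / (2 * v)) :
    complexGaussianVec N v {z | N * δ ≤ |∑ i, ‖(A *ᵥ z) i‖ ^ 2 - k * v|} ≤
      ENNReal.ofReal (2 * Real.exp (-(u * δ / (2 * v)) * N)) := by
  have hv0 : (0 : ℝ) < v := by positivity
  have hkN' : (k : ℝ) ≤ N := by exact_mod_cast hkN
  -- The condition `u ≤ δ / (2 v)` makes the second-order error at most half of the linear gain.
  have hexp : -(u * (N * δ / v)) + u ^ 2 * k ≤ -(u * δ / (2 * v)) * N := by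
    have h1 : u ^ 2 * k ≤ u * (δ / (2 * v)) * N := by
      rw [pow_two]
      have := hu.trans huδ
      gcongr
    have h2 : -(u * (N * δ / v)) + u * (δ / (2 * v)) * N = -(u * δ / (2 * v)) * N := by
      field_simp; ring
    linarith
  have hup := complexGaussianVec_chernoff hA h hk hv (s := -(u / v))
    (by rw [neg_mul, div_mul_cancel₀ _ hv0.ne']; linarith) (-(u / v) * (k * v + N * δ))
  have hlo := complexGaussianVec_chernoff hA h hk hv (s := u / v)
    (by rw [div_mul_cancel₀ _ hv0.ne']; linarith) (u / v * (k * v - N * δ))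
  rw [neg_mul (u / (v : ℝ)) (v : ℝ), div_mul_cancel₀ _ hv0.ne', ← sub_eq_add_neg] at hup
  rw [div_mul_cancel₀ _ hv0.ne'] at hlo
  have hup' : Real.exp (-(u / v) * (k * v + N * δ)) * (1 - u)⁻¹ ^ k ≤
      Real.exp (-(u * δ / (2 * v)) * N) := by
    calc _ ≤ Real.exp (-(u / v) * (k * v + N * δ)) * (Real.exp (u + u ^ 2)) ^ k := by
          gcongr
          · have : 0 < 1 - u := by linarith
            positivity
          · exact inv_one_sub_le_exp hu hu2
      _ = Real.exp (-(u * (N * δ / v)) + u ^ 2 * k) := by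
          rw [← Real.exp_nat_mul, ← Real.exp_add]
          congr 1
          field_simp
          ring
      _ ≤ _ := Real.exp_le_exp.mpr hexp
  have hlo' : Real.exp (u / v * (k * v - N * δ)) * (1 + u)⁻¹ ^ k ≤
      Real.exp (-(u * δ / (2 * v)) * N) := by
    calc _ ≤ Real.exp (u / v * (k * v - N * δ)) * (Real.exp (-u + u ^ 2)) ^ k := by
          gcongr
          exact inv_one_add_le_exp hu
      _ = Real.exp (-(u * (N * δ / v)) + u ^ 2 * k) := by
          rw [← Real.exp_nat_mul, ← Real.exp_add]
          congr 1
          field_simp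
          ring
      _ ≤ _ := Real.exp_le_exp.mpr hexp
  rw [two_mul, ENNReal.ofReal_add (Real.exp_nonneg _) (Real.exp_nonneg _)]
  refine (measure_mono (fun z hz => ?_)).trans ((measure_union_le _ _).trans (add_le_add
    (hup.trans (ENNReal.ofReal_le_ofReal hup')) (hlo.trans (ENNReal.ofReal_le_ofReal hlo'))))
  have huv : 0 ≤ u / v := by positivity
  have hz' : N * δ ≤ |∑ i, ‖(A *ᵥ z) i‖ ^ 2 - k * v| := hz
  rcases le_abs.mp hz' with h1 | h1
  · left
    have h2 : k * v + N * δ ≤ ∑ i, ‖(A *ᵥ z) i‖ ^ 2 := by linarith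
    exact mul_le_mul_of_nonpos_left h2 (by linarith)
  · right
    have h2 : ∑ i, ‖(A *ᵥ z) i‖ ^ 2 ≤ k * v - N * δ := by linarith
    exact mul_le_mul_of_nonneg_left h2 huv

/-- The energy of a complex Gaussian vector of variance `v ≥ w + g` in a subspace of dimension
`k ≥ N / 2` is unlikely to be close to the smaller value `k w`. -/
lemma complexGaussianVec_energy_small {N k : ℕ} {A : Matrix (Fin N) (Fin N) ℂ}
    (hA : A.IsHermitian) (h : A * A = A) (hk : A.trace = k) (hkN : (N : ℝ) / 2 ≤ k) {v : ℝ≥0}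
    {w g : ℝ} (hw : 0 < w) (hg : 0 < g) (hv : w + g ≤ v) :
    complexGaussianVec N v {z | ∑ i, ‖(A *ᵥ z) i‖ ^ 2 ≤ k * w + N * (g / 8)} ≤
      ENNReal.ofReal (Real.exp (-((g / (w + g)) ^ 2 / 16) * N)) := by
  have hv0 : (0 : ℝ) < v := by linarith
  set q := g / (w + g) with hq
  have hq0 : 0 < q := by positivity
  have hvne : v ≠ 0 := by rintro rfl; simp at hv0
  have hN0 : (0 : ℝ) ≤ N := Nat.cast_nonneg N
  -- The parameter is chosen so that `1 + s v = 1 + q / 2`, with `q` the relative gap between `w`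
  -- and `w + g`.
  have hlo := complexGaussianVec_chernoff hA h hk hvne (s := q / 2 / v)
    (by rw [div_mul_cancel₀ _ hv0.ne']; linarith) (q / 2 / v * (k * w + N * (g / 8)))
  rw [div_mul_cancel₀ _ hv0.ne'] at hlo
  refine (measure_mono fun z hz => ?_).trans (hlo.trans (ENNReal.ofReal_le_ofReal ?_))
  · have hz' : ∑ i, ‖(A *ᵥ z) i‖ ^ 2 ≤ k * w + N * (g / 8) := hz
    exact mul_le_mul_of_nonneg_left hz' (by positivity)
  · calc _ ≤ Real.exp (q / 2 / v * (k * w + N * (g / 8))) *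
          (Real.exp (-(q / 2) + (q / 2) ^ 2)) ^ k := by
          gcongr
          exact inv_one_add_le_exp (by positivity)
      _ = Real.exp (q / 2 * (k * (w / v) + N * ((g / v) / 8)) +
          k * (-(q / 2) + (q / 2) ^ 2)) := by
          rw [← Real.exp_nat_mul, ← Real.exp_add]
          congr 1
          field_simp
      _ ≤ _ := by
          apply Real.exp_le_exp.mpr
          have h1 : w / v ≤ 1 - q := by
            have : 1 - q = w / (w + g) := by rw [hq]; field_simp; ring
            rw [this]; gcongr
          have h2 : g / v ≤ q := by rw [hq]; gcongr
          have h3 : q / 2 * (k * (w / v) + N * ((g / v) / 8)) ≤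
              q / 2 * (k * (1 - q) + N * (q / 8)) := by gcongr
          -- The exponent is at most `-k q ^ 2 / 4 + N q ^ 2 / 16`, and `k ≥ N / 2` leaves `-N q ^ 2
          -- / 16`.
          nlinarith [mul_le_mul_of_nonneg_left hkN (sq_nonneg q)]

/-! ### Gaussian matrices -/

/-- The matrix with given columns. -/
def ofCols {N : ℕ} {ι : Type} (b : ι → Fin N → ℂ) : Matrix (Fin N) ι ℂ :=
  Matrix.of fun i j => b j i

/-- The Gram determinant of a family of vectors. -/
def gramDet {N : ℕ} {ι : Type} [Fintype ι] [DecidableEq ι] (b : ι → Fin N → ℂ) : ℂ :=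
  ((ofCols b)ᴴ * ofCols b).det

lemma rank_eq_card_iff_linearIndependent_col {m ι : Type*} [Fintype ι]
    (B : Matrix m ι ℂ) :
    B.rank = Fintype.card ι ↔ LinearIndependent ℂ B.col := by
  rw [linearIndependent_iff_card_eq_finrank_span, Set.finrank, ← Matrix.rank_eq_finrank_span_cols,
    eq_comm]

lemma continuous_ofCols {N : ℕ} {ι : Type} :
    Continuous (ofCols : (ι → Fin N → ℂ) → Matrix (Fin N) ι ℂ) :=
  continuous_matrix fun i j => (continuous_apply i).comp (continuous_apply j)

lemma continuous_gram {N : ℕ} {ι : Type} :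
    Continuous fun b : ι → Fin N → ℂ => (ofCols b)ᴴ * ofCols b :=
  (continuous_ofCols.matrix_conjTranspose).matrix_mul continuous_ofCols

section gramDet

variable {N : ℕ} {ι : Type} [Fintype ι] [DecidableEq ι]

-- `B* B` has the same rank as `B`. The determinant expresses the full-rank condition in a form that
-- is visibly measurable and that provides the inverse in `projPerp`.
open scoped ComplexOrder in
lemma gramDet_ne_zero_iff_rank (b : ι → Fin N → ℂ) :
    gramDet b ≠ 0 ↔ (ofCols b).rank = Fintype.card ι := by
  rw [← Matrix.rank_conjTranspose_mul_self, rank_eq_card_iff_linearIndependent_col,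
    Matrix.linearIndependent_cols_iff_isUnit, Matrix.isUnit_iff_isUnit_det, isUnit_iff_ne_zero]
  rfl

lemma gramDet_ne_zero_iff_linearIndependent (b : ι → Fin N → ℂ) :
    gramDet b ≠ 0 ↔ LinearIndependent ℂ b := by
  rw [gramDet_ne_zero_iff_rank, rank_eq_card_iff_linearIndependent_col]
  rfl

lemma measurable_gramDet : Measurable (gramDet : (ι → Fin N → ℂ) → ℂ) :=
  continuous_gram.matrix_det.measurable

/-- Inversion is not continuous at singular matrices, but the inverse is the adjugate times the
inverse of the determinant, with the value `0` in the singular case, and this is measurable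
everywhere. -/
lemma measurable_projPerp_apply (i j : Fin N) :
    Measurable fun b : ι → Fin N → ℂ => projPerp (ofCols b) i j := by
  have hinv : ∀ k l : ι, Measurable fun b : ι → Fin N → ℂ =>
      ((ofCols b)ᴴ * ofCols b)⁻¹ k l := fun k l => by
    simp_rw [Matrix.inv_def, Ring.inverse_eq_inv', Matrix.smul_apply, smul_eq_mul]
    refine (measurable_gramDet.inv).mul ?_
    exact (continuous_gram.matrix_adjugate.matrix_elem k l).measurable
  simp_rw [projPerp, Matrix.sub_apply, Matrix.mul_apply]
  refine measurable_const.sub (Finset.measurable_sum _ fun k _ => Measurable.mul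
    (Finset.measurable_sum _ fun l _ => Measurable.mul ?_ (hinv l k)) ?_)
  · exact (continuous_ofCols.matrix_elem i l).measurable
  · exact (continuous_ofCols.matrix_conjTranspose.matrix_elem k j).measurable

/-- The energy of the component of `z` orthogonal to the vectors `b`. -/
def residual (b : ι → Fin N → ℂ) (z : Fin N → ℂ) : ℝ :=
  ∑ i, ‖(projPerp (ofCols b) *ᵥ z) i‖ ^ 2

lemma measurable_residual :
    Measurable fun p : (ι → Fin N → ℂ) × (Fin N → ℂ) => residual p.1 p.2 := by
  unfold residual
  refine Finset.measurable_sum _ fun i _ => Measurable.pow_const (Measurable.norm ?_) 2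
  simp_rw [Matrix.mulVec, dotProduct]
  refine Finset.measurable_sum _ fun j _ => Measurable.mul ?_ ?_
  · exact (measurable_projPerp_apply i j).comp measurable_fst
  · exact (measurable_pi_apply j).comp measurable_snd

end gramDet

/-- The columns of `A` with index in `J`. -/
def colFamily {N M : ℕ} (A : Matrix (Fin N) (Fin M) ℂ) (J : Finset (Fin M)) :
    J → Fin N → ℂ :=
  fun j i => A i j

/-- The part of the observation `A x + n` that is independent of the columns with index in `J`. -/
def remainder {N M : ℕ} (x : Fin M → ℂ) (J : Finset (Fin M)) (A : Matrix (Fin N) (Fin M) ℂ)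
    (n : Fin N → ℂ) : Fin N → ℂ :=
  (∑ k : {k // k ∉ J}, x k • fun i => A i k) + n

lemma cols_eq_ofCols {N M : ℕ} (A : Matrix (Fin N) (Fin M) ℂ) (J : Finset (Fin M)) :
    cols A J = ofCols (colFamily A J) := rfl

/-- The energy of `x` outside of `J`, plus the noise variance. -/
def remainderVar {M : ℕ} (x : Fin M → ℂ) (J : Finset (Fin M)) (v : ℝ≥0) : ℝ≥0 :=
  ∑ k : {k // k ∉ J}, ‖x k‖₊ ^ 2 + v

/-- The target is a product measure: this is the independence of the remainder from the columns in
`J`. It turns conditioning on those columns into Fubini's theorem. -/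
lemma measurePreserving_colFamily_remainder {N M : ℕ} (x : Fin M → ℂ) (J : Finset (Fin M))
    (v : ℝ≥0) :
    MeasurePreserving (fun p : Matrix (Fin N) (Fin M) ℂ × (Fin N → ℂ) =>
      (colFamily p.1 J, remainder x J p.1 p.2))
      ((gaussianMatrix N M).prod (complexGaussianVec N v))
      ((Measure.pi fun _ : J => complexGaussianVec N 1).prod
        (complexGaussianVec N (remainderVar x J v))) := by
  have hm : Measurable (fun p : Matrix (Fin N) (Fin M) ℂ × (Fin N → ℂ) =>
      (colFamily p.1 J, remainder x J p.1 p.2)) := by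
    have hA : ∀ (i : Fin N) (k : Fin M),
        Measurable fun p : Matrix (Fin N) (Fin M) ℂ × (Fin N → ℂ) => p.1 i k := fun i k =>
      (measurable_pi_apply k).comp ((measurable_pi_apply i).comp
        (measurable_fst (α := Matrix (Fin N) (Fin M) ℂ)))
    refine Measurable.prodMk ?_ ?_
    · exact measurable_pi_lambda _ fun j => measurable_pi_lambda _ fun i => hA i j
    · unfold remainder
      refine Measurable.add (Finset.measurable_sum _ fun k _ => ?_) measurable_snd
      exact measurable_pi_lambda _ fun i => (hA i k).const_mul (x k)
  refine ⟨hm, ?_⟩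
  have htr : MeasurePreserving
      (fun a : Fin M → Fin N → ℂ => Matrix.of fun (i : Fin N) (j : Fin M) => a j i)
      (Measure.pi fun _ : Fin M => complexGaussianVec N 1) (gaussianMatrix N M) :=
    ⟨measurable_matrix_of_transpose N M, rfl⟩
  have htr' := htr.prod (MeasurePreserving.id (complexGaussianVec N v))
  have hsum : MeasurePreserving (fun p : ({k // k ∉ J} → Fin N → ℂ) × (Fin N → ℂ) =>
      (∑ k : {k // k ∉ J}, x k • p.1 k) + p.2)
      ((Measure.pi fun _ : {k // k ∉ J} => complexGaussianVec N 1).prod (complexGaussianVec N v))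
      (complexGaussianVec N (remainderVar x J v)) :=
    ⟨by fun_prop, map_sum_smul_add (fun k : {k // k ∉ J} => x k) v⟩
  have hsplit₀ : MeasurePreserving
      (MeasurableEquiv.piEquivPiSubtypeProd (fun _ : Fin M => Fin N → ℂ) (fun k => k ∈ J))
      (Measure.pi fun _ : Fin M => complexGaussianVec N 1)
      ((Measure.pi fun _ : {k // k ∈ J} => complexGaussianVec N 1).prod
        (Measure.pi fun _ : {k // k ∉ J} => complexGaussianVec N 1)) := by
    convert measurePreserving_piEquivPiSubtypeProd
      (fun _ : Fin M => complexGaussianVec N 1) (fun k => k ∈ J)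
  have hsplit := hsplit₀.prod (MeasurePreserving.id (complexGaussianVec N v))
  have hassoc := measurePreserving_prodAssoc
    (Measure.pi fun _ : {k // k ∈ J} => complexGaussianVec N 1)
    (Measure.pi fun _ : {k // k ∉ J} => complexGaussianVec N 1) (complexGaussianVec N v)
  have hall := ((MeasurePreserving.id (Measure.pi fun _ : {k // k ∈ J} =>
    complexGaussianVec N 1)).prod hsum).comp (hassoc.comp hsplit)
  rw [← htr'.map_eq, Measure.map_map hm htr'.measurable]
  exact hall.map_eq

/-- A bound for every fixed value of the columns in `J` gives a bound for the Gaussian matrix. -/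
lemma measure_colFamily_remainder_le {N M : ℕ} (x : Fin M → ℂ) (J : Finset (Fin M)) (v : ℝ≥0)
    {T : Set ((J → Fin N → ℂ) × (Fin N → ℂ))} (hT : MeasurableSet T) {ε : ℝ≥0∞}
    (h : ∀ b, complexGaussianVec N (remainderVar x J v) {z | (b, z) ∈ T} ≤ ε) :
    (gaussianMatrix N M).prod (complexGaussianVec N v)
      {p | (colFamily p.1 J, remainder x J p.1 p.2) ∈ T} ≤ ε := by
  have hmp := measurePreserving_colFamily_remainder (N := N) x J v
  have h1 := hmp.measure_preimage hT.nullMeasurableSet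
  refine (le_of_eq h1).trans ?_
  rw [Measure.prod_apply hT]
  refine (lintegral_mono fun b => h b).trans ?_
  simp

/-- At most `N` independent complex Gaussian vectors in `ℂ ^ N` are almost surely linearly
independent. -/
lemma ae_gramDet_ne_zero {N M : ℕ} (J : Finset (Fin M)) (hJ : J.card ≤ N) :
    ∀ᵐ a ∂(Measure.pi fun _ : Fin M => complexGaussianVec N 1),
      gramDet (fun j : J => a j) ≠ 0 := by
  induction J using Finset.induction_on with
  | empty =>
    refine Eventually.of_forall fun a => ?_
    rw [gramDet_ne_zero_iff_linearIndependent]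
    exact linearIndependent_empty_type
  | insert j J hj ih =>
    rw [Finset.card_insert_of_notMem hj] at hJ
    have ih := ih (by omega)
    have hmeas : ∀ K : Finset (Fin M),
        Measurable fun a : Fin M → Fin N → ℂ => gramDet (fun j : K => a j) := fun K =>
      measurable_gramDet.comp (measurable_pi_lambda _ fun j => measurable_pi_apply _)
    set E : Set (Fin M → Fin N → ℂ) :=
      {a | gramDet (fun k : (insert j J : Finset (Fin M)) => a k) = 0} ∩
        {a | gramDet (fun k : J => a k) ≠ 0} with hE
    have hEm : MeasurableSet E :=
      ((hmeas _) (measurableSet_singleton 0)).inter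
        ((hmeas _) (measurableSet_singleton 0).compl)
    have hmp := (measurePreserving_piEquivPiSubtypeProd
      (fun _ : Fin M => complexGaussianVec N 1) (fun k => k ∈ J)).symm
    have hE0 : (Measure.pi fun _ : Fin M => complexGaussianVec N 1) E = 0 := by
      rw [← hmp.measure_preimage hEm.nullMeasurableSet,
        Measure.measure_prod_null (hmp.measurable hEm)]
      -- With the columns in `J` fixed, the event forces column `j` into their span. This is a
      -- proper subspace because `J` has fewer than `N` elements, hence a null set for column `j`.
      refine Eventually.of_forall fun b => ?_
      set S := Submodule.span ℂ (Set.range b) with hS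
      have hStop : S ≠ ⊤ := fun h => by
        have h1 : Module.finrank ℂ S ≤ Fintype.card {k // k ∈ J} := finrank_range_le_card b
        rw [h, finrank_top, Module.finrank_pi, Fintype.card_fin, Fintype.card_coe] at h1
        omega
      have hS0 := complexGaussianVec_submodule (v := 1) one_ne_zero hStop
      have hSm : MeasurableSet (S : Set (Fin N → ℂ)) := S.closed_of_finiteDimensional.measurableSet
      rw [← (measurePreserving_eval (fun _ : {k // k ∉ J} => complexGaussianVec N 1)
        ⟨j, hj⟩).measure_preimage hSm.nullMeasurableSet] at hS0
      refine measure_mono_null (fun c hc => ?_) hS0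
      obtain ⟨a, ha⟩ : ∃ a, a = (MeasurableEquiv.piEquivPiSubtypeProd
        (fun _ : Fin M => Fin N → ℂ) (fun k => k ∈ J)).symm (b, c) := ⟨_, rfl⟩
      have hc' : a ∈ E := by rw [ha]; exact hc
      have hab : (MeasurableEquiv.piEquivPiSubtypeProd
        (fun _ : Fin M => Fin N → ℂ) (fun k => k ∈ J)) a = (b, c) := by
        rw [ha, MeasurableEquiv.apply_symm_apply]
      have hb : (fun k : J => a k) = b := congrArg Prod.fst hab
      have hcj : a j = c ⟨j, hj⟩ := congrFun (congrArg Prod.snd hab) ⟨j, hj⟩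
      have h1 : ¬ LinearIndepOn ℂ a (insert j J : Finset (Fin M)) := fun hli =>
        (gramDet_ne_zero_iff_linearIndependent _).mpr hli hc'.1
      have h2 : LinearIndepOn ℂ a (J : Set (Fin M)) :=
        (gramDet_ne_zero_iff_linearIndependent (fun k : J => a k)).mp hc'.2
      rw [Finset.coe_insert, linearIndepOn_insert (by simpa using hj)] at h1
      have h3 : a j ∈ Submodule.span ℂ (a '' (J : Set (Fin M))) := by
        by_contra h; exact h1 ⟨h2, h⟩
      have h4 : a '' (J : Set (Fin M)) = Set.range b := by
        rw [← hb, Set.image_eq_range]; rfl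
      rw [h4, hcj] at h3
      exact h3
    filter_upwards [ih, measure_eq_zero_iff_ae_notMem.mp hE0] with a h1 h2 h3
    exact h2 ⟨h3, h1⟩

lemma gaussianMatrix_gramDet_eq_zero {N M : ℕ} (J : Finset (Fin M)) (hJ : J.card ≤ N) (v : ℝ≥0) :
    (gaussianMatrix N M).prod (complexGaussianVec N v)
      {p | gramDet (colFamily p.1 J) = 0} = 0 := by
  have h := ae_gramDet_ne_zero (N := N) J hJ
  have hm : Measurable fun A : Matrix (Fin N) (Fin M) ℂ => gramDet (colFamily A J) :=
    measurable_gramDet.comp (measurable_pi_lambda _ fun j => measurable_pi_lambda _ fun i =>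
      (measurable_pi_apply (j : Fin M)).comp (measurable_pi_apply i))
  have hms : MeasurableSet {A : Matrix (Fin N) (Fin M) ℂ | gramDet (colFamily A J) = 0} :=
    hm (measurableSet_singleton 0)
  have h1 : gaussianMatrix N M {A | gramDet (colFamily A J) = 0} = 0 := by
    rw [gaussianMatrix, Measure.map_apply (measurable_matrix_of_transpose N M) hms,
      measure_eq_zero_iff_ae_notMem]
    exact h
  have h2 : {p : Matrix (Fin N) (Fin M) ℂ × (Fin N → ℂ) | gramDet (colFamily p.1 J) = 0} =
      {A | gramDet (colFamily A J) = 0} ×ˢ Set.univ := by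
    ext p; simp
  rw [h2, Measure.prod_prod, h1, zero_mul]

/-! ### The joint typicality decoder -/

lemma mulVec_add_eq_cols_mulVec_add_remainder {N M : ℕ} (x : Fin M → ℂ) (J : Finset (Fin M))
    (A : Matrix (Fin N) (Fin M) ℂ) (n : Fin N → ℂ) :
    A *ᵥ x + n = cols A J *ᵥ (fun j : J => x j) + remainder x J A n := by
  rw [remainder, ← add_assoc]
  congr 1
  ext i
  rw [Pi.add_apply, Finset.sum_apply, Matrix.mulVec, Matrix.mulVec, dotProduct, dotProduct]
  rw [← Fintype.sum_subtype_add_sum_subtype (fun k => k ∈ J) fun k => A i k * x k]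
  congr 1
  · convert rfl
    rfl
  · exact Finset.sum_congr rfl fun k _ => mul_comm _ _

/-- The projection annihilates the contribution of the columns in `J`, so only the remainder is
left. -/
lemma sum_norm_projPerp_observation {N M : ℕ} (x : Fin M → ℂ) {J : Finset (Fin M)}
    {A : Matrix (Fin N) (Fin M) ℂ} (n : Fin N → ℂ) (hJ : gramDet (colFamily A J) ≠ 0) :
    ∑ i, ‖(projPerp (cols A J) *ᵥ (A *ᵥ x + n)) i‖ ^ 2 =
      residual (colFamily A J) (remainder x J A n) := by
  rw [mulVec_add_eq_cols_mulVec_add_remainder x J, Matrix.mulVec_add, Matrix.mulVec_mulVec,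
    cols_eq_ofCols, projPerp_mul_self_eq_zero hJ, Matrix.zero_mulVec, zero_add]
  rfl

lemma jointlyTypical_iff {N M L : ℕ} (hN : 0 < N) (ν δ : ℝ) (x : Fin M → ℂ)
    (A : Matrix (Fin N) (Fin M) ℂ) (n : Fin N → ℂ) (J : Finset (Fin M)) :
    JointlyTypical L ν δ A (A *ᵥ x + n) J ↔ J.card = L ∧ gramDet (colFamily A J) ≠ 0 ∧
      |residual (colFamily A J) (remainder x J A n) - ((N : ℝ) - L) * ν ^ 2| < N * δ := by
  have hN' : (0 : ℝ) < N := by exact_mod_cast hN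
  unfold JointlyTypical
  refine and_congr_right fun hc => ?_
  have hr : (cols A J).rank = L ↔ gramDet (colFamily A J) ≠ 0 := by
    rw [gramDet_ne_zero_iff_rank, cols_eq_ofCols, Fintype.card_coe, hc]
  rw [hr]
  refine and_congr_right fun hd => ?_
  rw [sum_norm_projPerp_observation x n hd]
  have h : 1 / (N : ℝ) * residual (colFamily A J) (remainder x J A n) - ((N : ℝ) - L) / N * ν ^ 2
      = (residual (colFamily A J) (remainder x J A n) - ((N : ℝ) - L) * ν ^ 2) / N := by
    field_simp
  rw [h, abs_div, abs_of_pos hN', div_lt_iff₀ hN', mul_comm δ]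

lemma trace_projPerp_ofCols {N k : ℕ} {ι : Type} [Fintype ι] [DecidableEq ι]
    {b : ι → Fin N → ℂ} (hb : gramDet b ≠ 0) (hk : Fintype.card ι + k = N) :
    (projPerp (ofCols b)).trace = k := by
  rw [trace_projPerp hb, ← hk]
  push_cast
  ring

/-- The event that the residual of the observation, projected along the columns in `J`, lies
in `S`. -/
def residualEvent {N M : ℕ} (x : Fin M → ℂ) (J : Finset (Fin M)) (S : Set ℝ) :
    Set (Matrix (Fin N) (Fin M) ℂ × (Fin N → ℂ)) :=
  {p | (colFamily p.1 J, remainder x J p.1 p.2) ∈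
    {q : (J → Fin N → ℂ) × (Fin N → ℂ) | gramDet q.1 ≠ 0 ∧ residual q.1 q.2 ∈ S}}

lemma measurableSet_gramDet_residual {N : ℕ} {ι : Type} [Fintype ι] [DecidableEq ι] {S : Set ℝ}
    (hS : MeasurableSet S) :
    MeasurableSet {q : (ι → Fin N → ℂ) × (Fin N → ℂ) | gramDet q.1 ≠ 0 ∧ residual q.1 q.2 ∈ S} :=
  ((measurable_gramDet.comp measurable_fst) (measurableSet_singleton 0).compl).inter
    (measurable_residual hS)

lemma measurableSet_residualEvent {N M : ℕ} (x : Fin M → ℂ) (J : Finset (Fin M)) {S : Set ℝ}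
    (hS : MeasurableSet S) : MeasurableSet (residualEvent (N := N) x J S) :=
  (measurePreserving_colFamily_remainder x J 0).measurable (measurableSet_gramDet_residual hS)

/-- Nondegeneracy is built into the event, so the conditional bound is needed only where `projPerp`
really is an orthogonal projection. -/
lemma measure_residualEvent_le {N M : ℕ} (x : Fin M → ℂ) (J : Finset (Fin M)) (v : ℝ≥0)
    {S : Set ℝ} (hS : MeasurableSet S) {ε : ℝ≥0∞}
    (h : ∀ b : J → Fin N → ℂ, gramDet b ≠ 0 →
      complexGaussianVec N (remainderVar x J v)
        {z | ∑ i, ‖(projPerp (ofCols b) *ᵥ z) i‖ ^ 2 ∈ S} ≤ ε) :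
    (gaussianMatrix N M).prod (complexGaussianVec N v) (residualEvent x J S) ≤ ε := by
  refine measure_colFamily_remainder_le x J v (measurableSet_gramDet_residual hS) fun b => ?_
  by_cases hb : gramDet b = 0
  · refine le_of_eq_of_le ?_ zero_le
    convert measure_empty (μ := complexGaussianVec N (remainderVar x J v))
    ext z
    simp [hb]
  · refine (measure_mono fun z hz => ?_).trans (h b hb)
    exact hz.2

/-- Used to translate failure to capture the energy into missed energy of at least `γ P`, which
raises the variance of the remainder. -/
lemma sum_compl_norm_sq {M : ℕ} (x : Fin M → ℂ) (J : Finset (Fin M)) :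
    ∑ k ∈ J ∩ supp x, ‖x k‖ ^ 2 + ∑ k : {k // k ∉ J}, ‖x k‖ ^ 2 = ∑ k, ‖x k‖ ^ 2 := by
  rw [← Fintype.sum_subtype_add_sum_subtype (fun k => k ∈ J) fun k => ‖x k‖ ^ 2]
  congr 1
  rw [← Finset.sum_subtype J (fun _ => Iff.rfl) fun k => ‖x k‖ ^ 2]
  refine Finset.sum_subset Finset.inter_subset_left fun k hk hk' => ?_
  have : x k = 0 := by
    by_contra h
    exact hk' (Finset.mem_inter.mpr ⟨hk, by simp [supp, h]⟩)
  simp [this]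

lemma coe_remainderVar {M : ℕ} (x : Fin M → ℂ) (J : Finset (Fin M)) (v : ℝ≥0) :
    (remainderVar x J v : ℝ) = ∑ k : {k // k ∉ J}, ‖x k‖ ^ 2 + v := by
  simp [remainderVar]

/-- The error probability has a measurable majorant with exponentially small mean. -/
lemma exists_majorant_pErr {N M L : ℕ} (hN : 0 < N) (hLN : 2 * L ≤ N) {γ P ν u : ℝ}
    (hγ : 0 < γ) (hP : 0 < P) (hν : 0 < ν) {x : Fin M → ℂ} (hx : (supp x).card = L)
    (hxP : ∑ i, ‖x i‖ ^ 2 = P) (hu : 0 ≤ u) (hu2 : u ≤ 1 / 2)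
    (huδ : u ≤ γ * P / 8 / (2 * ν ^ 2))
    {D : Matrix (Fin N) (Fin M) ℂ → (Fin N → ℂ) → Finset (Fin M)}
    (hD : IsTypicalityDecoder L ν (γ * P / 8) D) :
    ∃ g : Matrix (Fin N) (Fin M) ℂ → ℝ≥0∞, Measurable g ∧ (∀ A, pErr γ P ν D x A ≤ g A) ∧
      ∫⁻ A, g A ∂(gaussianMatrix N M) ≤
        ENNReal.ofReal (2 * Real.exp (-(u * (γ * P / 8) / (2 * ν ^ 2)) * N)) +
        2 ^ M * ENNReal.ofReal (Real.exp (-((γ * P / (ν ^ 2 + γ * P)) ^ 2 / 16) * N)) := by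
  classical
  obtain ⟨k, hk⟩ : ∃ k, L + k = N := ⟨N - L, by omega⟩
  have hkN : (N : ℝ) / 2 ≤ k := by
    have : N ≤ 2 * k := by omega
    have : (N : ℝ) ≤ 2 * k := by exact_mod_cast this
    linarith
  have hNL : (N : ℝ) - L = k := by rw [← hk]; push_cast; ring
  set v : ℝ≥0 := (ν ^ 2).toNNReal with hv
  have hvν : (v : ℝ) = ν ^ 2 := Real.coe_toNNReal _ (by positivity)
  have hgP : 0 < γ * P := by positivity
  set F : Finset (Finset (Fin M)) := Finset.univ.filter fun J =>
    J.card = L ∧ γ * P ≤ ∑ k : {k // k ∉ J}, ‖x k‖ ^ 2 with hF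
  set S₀ : Set ℝ := {t | N * (γ * P / 8) ≤ |t - k * ν ^ 2|} with hS₀
  set S₁ : Set ℝ := {t | t ≤ k * ν ^ 2 + N * (γ * P / 8)} with hS₁
  have hS₀m : MeasurableSet S₀ := measurableSet_le (by fun_prop) (by fun_prop)
  have hS₁m : MeasurableSet S₁ := measurableSet_le (by fun_prop) (by fun_prop)
  set Z : Set (Matrix (Fin N) (Fin M) ℂ × (Fin N → ℂ)) :=
    {p | gramDet (colFamily p.1 (supp x)) = 0} with hZ
  have hZm : MeasurableSet Z :=
    (measurable_gramDet.comp ((measurable_fst (β := Fin N → ℂ)).comp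
      (measurePreserving_colFamily_remainder (N := N) x (supp x) 0).measurable))
      (measurableSet_singleton 0)
  -- The bad event does not mention `D`: the true support is degenerate or atypical, or some set
  -- missing energy `γ P` has a small residual.
  set E : Set (Matrix (Fin N) (Fin M) ℂ × (Fin N → ℂ)) :=
    Z ∪ residualEvent x (supp x) S₀ ∪ ⋃ J ∈ F, residualEvent x J S₁ with hE
  have hEm : MeasurableSet E :=
    (hZm.union (measurableSet_residualEvent x _ hS₀m)).union
      (Finset.measurableSet_biUnion F fun J _ => measurableSet_residualEvent x J hS₁m)
  -- The majorant is the conditional probability of `E` given `A`, measurable in `A` whatever the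
  -- decoder.
  refine ⟨fun A => complexGaussianVec N v (Prod.mk A ⁻¹' E), measurable_measure_prodMk_left hEm,
    fun A => measure_mono fun n hn => ?_, ?_⟩
  · by_contra hnE
    have hnE' : (A, n) ∉ E := hnE
    simp only [hE, Set.mem_union, not_or, Set.mem_iUnion, not_exists] at hnE'
    obtain ⟨⟨h1, h2⟩, h3⟩ := hnE'
    have h1' : gramDet (colFamily A (supp x)) ≠ 0 := h1
    -- Off `E` the true support is typical, so the decoder must output a typical set. If that set
    -- failed, it would lie in `F` with a small residual, contradicting `h3`.
    have htyp : JointlyTypical L ν (γ * P / 8) A (A *ᵥ x + n) (supp x) := by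
      rw [jointlyTypical_iff hN, hNL]
      refine ⟨hx, h1', ?_⟩
      by_contra hc
      exact h2 ⟨h1', not_lt.mp hc⟩
    have hJ := hD A (A *ᵥ x + n) ⟨_, htyp⟩
    rw [jointlyTypical_iff hN, hNL] at hJ
    obtain ⟨hJ1, hJ2, hJ3⟩ := hJ
    have hn' : ¬ (1 - γ) * P < ∑ k ∈ D A (A *ᵥ x + n) ∩ supp x, ‖x k‖ ^ 2 := hn
    have hsum := sum_compl_norm_sq x (D A (A *ᵥ x + n))
    refine h3 (D A (A *ᵥ x + n)) ?_ ⟨hJ2, ?_⟩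
    · simp only [hF, Finset.mem_filter, Finset.mem_univ, true_and]
      exact ⟨hJ1, by linarith [not_lt.mp hn']⟩
    -- Only the upper half of the typicality condition is needed to exclude wrong sets.
    · have := (abs_lt.mp hJ3).2
      have h4 : residual (colFamily A (D A (A *ᵥ x + n)))
          (remainder x (D A (A *ᵥ x + n)) A n) ≤ k * ν ^ 2 + N * (γ * P / 8) := by linarith
      exact h4
  · rw [← Measure.prod_apply hEm]
    have hZ0 : (gaussianMatrix N M).prod (complexGaussianVec N v) Z = 0 :=
      gaussianMatrix_gramDet_eq_zero (supp x) (by omega) v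
    refine (measure_union_le _ _).trans (add_le_add ((measure_union_le _ _).trans ?_) ?_)
    · rw [hZ0, zero_add]
      refine measure_residualEvent_le x (supp x) v hS₀m fun b hb => ?_
      have hvar : remainderVar x (supp x) v = v := by
        rw [remainderVar, Finset.sum_eq_zero, zero_add]
        rintro ⟨i, hi⟩ -
        have : x i = 0 := by
          by_contra h
          exact hi (by simp [supp, h])
        simp [this]
      rw [hvar, ← hvν]
      have := complexGaussianVec_deviation (projPerp_isHermitian (ofCols b))
        (projPerp_mul_projPerp hb) (trace_projPerp_ofCols hb (by rw [Fintype.card_coe, hx, hk]))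
        (by omega) (v := v) (δ := γ * P / 8) (u := u)
        (by rw [hv]; positivity) hu hu2
        (by rw [hvν]; exact huδ)
      refine le_trans (le_of_eq ?_) this
      rw [hvν]
      rfl
    · refine (measure_biUnion_finset_le F _).trans ?_
      have hbound : ∀ J ∈ F, (gaussianMatrix N M).prod (complexGaussianVec N v)
          (residualEvent x J S₁) ≤
          ENNReal.ofReal (Real.exp (-((γ * P / (ν ^ 2 + γ * P)) ^ 2 / 16) * N)) := by
        intro J hJ
        simp only [hF, Finset.mem_filter, Finset.mem_univ, true_and] at hJ
        refine measure_residualEvent_le x J v hS₁m fun b hb => ?_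
        exact complexGaussianVec_energy_small (projPerp_isHermitian (ofCols b))
          (projPerp_mul_projPerp hb)
          (trace_projPerp_ofCols hb (by rw [Fintype.card_coe, hJ.1, hk])) hkN
          (by positivity) hgP (by rw [coe_remainderVar, hvν]; linarith [hJ.2])
      refine (Finset.sum_le_sum hbound).trans ?_
      rw [Finset.sum_const, nsmul_eq_mul]
      gcongr
      have : F.card ≤ 2 ^ M := by
        refine (Finset.card_le_univ F).trans ?_
        simp
      exact_mod_cast this

/-! ### Exponential decay -/

/-- Halving the rate absorbs the constant for large `M`. -/
lemma expDecay_of_le_mul_exp {f : ℕ → ℝ≥0∞} {C c : ℝ} (hC : 0 < C) (hc : 0 < c)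
    (h : ∀ᶠ M : ℕ in atTop, f M ≤ ENNReal.ofReal (C * Real.exp (-c * M))) : ExpDecay f := by
  refine ⟨c / 2, by positivity, ?_⟩
  have hlarge : ∀ᶠ M : ℕ in atTop, Real.log C ≤ c / 2 * M :=
    (tendsto_natCast_atTop_atTop.const_mul_atTop (by positivity)).eventually_ge_atTop _
  filter_upwards [h, hlarge] with M h1 h2
  refine h1.trans (ENNReal.ofReal_le_ofReal ?_)
  rw [← Real.exp_log hC, ← Real.exp_add, Real.exp_le_exp]
  linarith

lemma ExpDecay.tendsto_zero {f : ℕ → ℝ≥0∞} (h : ExpDecay f) : Tendsto f atTop (𝓝 0) := by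
  obtain ⟨c, hc, h⟩ := h
  refine tendsto_of_tendsto_of_tendsto_of_le_of_le' tendsto_const_nhds ?_
    (Eventually.of_forall fun _ => zero_le) h
  have h1 : Tendsto (fun M : ℕ => Real.exp (-c * M)) atTop (𝓝 0) :=
    Real.tendsto_exp_atBot.comp (tendsto_natCast_atTop_atTop.const_mul_atTop_of_neg (by linarith))
  simpa using ENNReal.tendsto_ofReal h1

end SparseRecovery

end

/-! ### Choice of constants and conclusion -/

theorem theorem5 (β γ P ν : ℝ) (hβ : 2 < β) (hγ : γ ∈ Set.Ioo (0 : ℝ) 1) (hP : 0 < P)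
    (hν : 0 < ν) :
    ∃ C₅ : ℝ, 1 < C₅ ∧ ∃ δ : ℝ, 0 < δ ∧
      ∀ (x : (M : ℕ) → Fin M → ℂ) (N : ℕ → ℕ)
        (D : (M : ℕ) → Matrix (Fin (N M)) (Fin M) ℂ → (Fin (N M) → ℂ) → Finset (Fin M)),
        (∀ᶠ M : ℕ in atTop, (SparseRecovery.supp (x M)).card = ⌊(M : ℝ) / β⌋₊) →
        (∀ᶠ M : ℕ in atTop, ∑ i, ‖x M i‖ ^ 2 = P) →
        (∀ᶠ M : ℕ in atTop, C₅ * (⌊(M : ℝ) / β⌋₊ : ℝ) < (N M : ℝ)) →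
        (∀ᶠ M : ℕ in atTop,
          SparseRecovery.IsTypicalityDecoder ⌊(M : ℝ) / β⌋₊ ν δ (D M)) →
        Tendsto (fun M => SparseRecovery.pErrAvg γ P ν (D M) (x M)) atTop (𝓝 0) ∧
        SparseRecovery.ExpDecay (fun M => SparseRecovery.pErrAvg γ P ν (D M) (x M)) ∧
        ∀ ξ : ℝ, 0 < ξ → ξ ≤ 1 →
          SparseRecovery.ExpDecay (fun M => SparseRecovery.gaussianMatrix (N M) M
            {A | ENNReal.ofReal ξ < SparseRecovery.pErr γ P ν (D M) (x M) A}) := by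
  obtain ⟨hγ0, -⟩ := hγ
  set q : ℝ := (γ * P / (ν ^ 2 + γ * P)) ^ 2 / 16 with hq
  have hq0 : 0 < q := by positivity
  -- The two bounds on `u` are the ones required by `complexGaussianVec_deviation` with variance `ν
  -- ^ 2` and `δ = γ P / 8`.
  set u : ℝ := min (1 / 2) (γ * P / 8 / (2 * ν ^ 2)) with hu
  have hu0 : 0 < u := by positivity
  set c₀ : ℝ := u * (γ * P / 8) / (2 * ν ^ 2) with hc₀
  have hc₀0 : 0 < c₀ := by positivity
  have hβ0 : 0 < β := by linarith
  -- The constant `2` ensures `N - L ≥ N / 2`. The constant `2 β / q` ensures `M ≤ q N`, because `L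
  -- ≥ M / (2 β)` for large `M`.
  refine ⟨max 2 (2 * β / q), lt_max_of_lt_left one_lt_two, γ * P / 8, by positivity, ?_⟩
  intro x N D hsupp hsum hN hD
  -- The deviation term decays at rate `c₀ N ≥ (c₀ / β) M`. In the union bound `2 ^ M * exp (-q N) ≤
  -- exp ((log 2 - 1) M)`, and `log 2 ≤ 7 / 10` leaves the rate `3 / 10`.
  set c : ℝ := min (c₀ / β) (3 / 10) with hc
  have hc0 : 0 < c := by positivity
  have key : ∀ᶠ M : ℕ in atTop, ∃ g : Matrix (Fin (N M)) (Fin M) ℂ → ℝ≥0∞, Measurable g ∧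
      (∀ A, SparseRecovery.pErr γ P ν (D M) (x M) A ≤ g A) ∧
      ∫⁻ A, g A ∂(SparseRecovery.gaussianMatrix (N M) M) ≤
        ENNReal.ofReal (3 * Real.exp (-c * M)) := by
    -- From here on `M / β ≥ 2`, so taking the floor loses at most half of it.
    have hMlarge : ∀ᶠ M : ℕ in atTop, 2 * β ≤ (M : ℝ) :=
      tendsto_natCast_atTop_atTop.eventually_ge_atTop _
    filter_upwards [hsupp, hsum, hN, hD, hMlarge] with M h1 h2 h3 h4 h5
    set L : ℕ := ⌊(M : ℝ) / β⌋₊ with hL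
    have hLM : (M : ℝ) / (2 * β) ≤ L := by
      have hfl := Nat.lt_floor_add_one ((M : ℝ) / β)
      rw [← hL] at hfl
      have h6 : 1 ≤ (M : ℝ) / (2 * β) := by rw [le_div_iff₀ (by positivity)]; linarith
      have h7 : (M : ℝ) / β = M / (2 * β) + M / (2 * β) := by field_simp; ring
      linarith
    have hL0 : (0 : ℝ) ≤ L := Nat.cast_nonneg L
    have hN2 : (2 : ℝ) * L < N M :=
      lt_of_le_of_lt (mul_le_mul_of_nonneg_right (le_max_left _ _) hL0) h3
    have hNq : 2 * β / q * L < N M :=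
      lt_of_le_of_lt (mul_le_mul_of_nonneg_right (le_max_right _ _) hL0) h3
    have hN2' : 2 * L < N M := by exact_mod_cast hN2
    have hMN : (M : ℝ) ≤ q * N M := by
      calc (M : ℝ) = q * (2 * β / q * (M / (2 * β))) := by field_simp
        _ ≤ q * (2 * β / q * L) := by gcongr
        _ ≤ q * N M := by gcongr
    have hMN2 : (M : ℝ) / β ≤ N M := by
      have h7 : (M : ℝ) / β = 2 * (M / (2 * β)) := by field_simp
      rw [h7]; linarith
    obtain ⟨g, hg, hle, hint⟩ := SparseRecovery.exists_majorant_pErr (by omega) hN2'.le hγ0 hP hν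
      h1 h2 hu0.le (min_le_left _ _) (min_le_right _ _) h4
    refine ⟨g, hg, hle, hint.trans ?_⟩
    have h2M : (2 : ℝ≥0∞) ^ M = ENNReal.ofReal (2 ^ M) := by
      rw [ENNReal.ofReal_pow zero_le_two]; simp
    rw [h2M, ← ENNReal.ofReal_mul (by positivity),
      ← ENNReal.ofReal_add (by positivity) (by positivity)]
    refine ENNReal.ofReal_le_ofReal ?_
    have hM0 : (0 : ℝ) ≤ M := Nat.cast_nonneg M
    have e1 : Real.exp (-c₀ * N M) ≤ Real.exp (-c * M) := by
      rw [Real.exp_le_exp, neg_mul, neg_mul, neg_le_neg_iff]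
      calc c * M ≤ c₀ / β * M := by gcongr; exact min_le_left _ _
        _ = c₀ * (M / β) := by ring
        _ ≤ c₀ * N M := by gcongr
    have e2 : 2 ^ M * Real.exp (-q * N M) ≤ Real.exp (-c * M) := by
      have : (2 : ℝ) ^ M = Real.exp (Real.log 2 * M) := by
        rw [mul_comm, Real.exp_nat_mul, Real.exp_log two_pos]
      rw [this, ← Real.exp_add, Real.exp_le_exp]
      have hlog : Real.log 2 ≤ 7 / 10 := by linarith [Real.log_two_lt_d9]
      have h8 : Real.log 2 * M ≤ 7 / 10 * M := by gcongr
      have h9 : c * M ≤ 3 / 10 * M := by gcongr; exact min_le_right _ _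
      linarith
    linarith
  have hdecay : SparseRecovery.ExpDecay
      (fun M => SparseRecovery.pErrAvg γ P ν (D M) (x M)) := by
    refine SparseRecovery.expDecay_of_le_mul_exp (C := 3) (by norm_num) hc0 ?_
    filter_upwards [key] with M ⟨g, _, hle, hint⟩
    exact (lintegral_mono hle).trans hint
  refine ⟨hdecay.tendsto_zero, hdecay, fun ξ hξ _ => ?_⟩
  refine SparseRecovery.expDecay_of_le_mul_exp (C := 3 / ξ) (by positivity) hc0 ?_
  filter_upwards [key] with M ⟨g, hg, hle, hint⟩
  have hξ' : ENNReal.ofReal ξ ≠ 0 := by simpa using hξ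
  -- Markov's inequality is applied to the measurable majorant `g`, since `pErr` itself need not be
  -- measurable in `A`.
  calc SparseRecovery.gaussianMatrix (N M) M
        {A | ENNReal.ofReal ξ < SparseRecovery.pErr γ P ν (D M) (x M) A}
      ≤ SparseRecovery.gaussianMatrix (N M) M {A | ENNReal.ofReal ξ ≤ g A} := by
        refine measure_mono fun A hA => ?_
        have hA' : ENNReal.ofReal ξ < SparseRecovery.pErr γ P ν (D M) (x M) A := hA
        exact hA'.le.trans (hle A)
    _ ≤ (∫⁻ A, g A ∂(SparseRecovery.gaussianMatrix (N M) M)) / ENNReal.ofReal ξ :=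
        meas_ge_le_lintegral_div hg.aemeasurable hξ' ENNReal.ofReal_ne_top
    _ ≤ ENNReal.ofReal (3 * Real.exp (-c * M)) / ENNReal.ofReal ξ := by gcongr
    _ = ENNReal.ofReal (3 / ξ * Real.exp (-c * M)) := by
        rw [← ENNReal.ofReal_div_of_pos hξ]
        congr 1
        ring
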